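/- Let $-\infty\le x_-<x_+\le+\infty$, $I=\{x\in\mathbb R: x_-\le x\le x_+\}$ (for instance $x_\pm=\pm\ell/2$ with $0<\ell\le\infty$), and let $\mathfrak F=\bigoplus_{N\ge 0}L^2(I)^{\odot N}$ be the bosonic Fock space over $L^2(I)$, with field operator $\psi(x)$, $[\psi(x),\psi^\dagger(y)]=\delta(x-y)$, and vacuum $|\Omega\rangle$. For $D\times D$ matrix-valued functions $Q,L,R,T$ on $I$ and a matrix $B\in M_D(\mathbb C)$, the continuous matrix product operator (cMPO) with these tensors is $$O[B,Q,L,R,T]=\mathrm{Tr}_D\Big(B\,\mathcal P e^{\int_I dx\,(Q(x)\otimes \mathrm{Id}+L(x)\otimes l_x+R(x)\otimes r_x+T(x)\otimes \mathrm{Ad}_x)}\Big)(|\Omega\rangle\langle\Omega|),$$ where $l_x[\cdot]=\psi^\dagger(x)[\cdot]$, $r_x[\cdot]=[\cdot]\psi(x)$, $\mathrm{Ad}_x[\cdot]=\psi^\dagger(x)[\cdot]\psi(x)$, and positions increase from left to right in path-ordered products; it is understood through its matrix elements between vectors of fixed particle number, obtained by expanding the path-ordered exponential. Write $V_s^t=\mathcal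 P\exp\int_s^t Q(z)\,dz$ for the free propagator (with $V_s^t=(V_t^s)^{-1}$). **Proposition.** Let $k\in\{1,\dots,D\}$, let $q_1,\dots,q_D$ be real-valued functions integrable on $I$, and put $Q(x)=i\,\mathrm{diag}(q_1(x),\dots,q_D(x))$. For every $x\in I$ let $T(x)\in U(1)^D\rtimes S_D$ be a generalized permutation matrix, i.e. $T(x)=e^{i\,\mathrm{diag}(t_1(x),\dots,t_D(x))}P(x)$ with $t_j(x)\in\mathbb R$ and $P(x)$ a permutation matrix, with entries depending measurably on $x$. Let $B=V_{x_+}^{x_-}\,|k)(+|$, where $|k)$ is the $k$-th standard basis vector and $(+|=(1,1,\dots,1)$. Then these tensors with $L=R=0$ give rise to a phase cMPU. That is, there is exactly one bounded operator $U$ on $\mathfrak F$ which is the cMPO $O[B,Q,0,0,T]$; this $U$ is unitary; and there are functions $\theta_j:I^j\to\mathbb R$, $j\ge 0$, such that all continuous matrix-product coefficients are phases, $$\mathrm{Tr}\big(B\,V_{x_-}^{x_1}T(x_1)V_{x_1}^{x_2}T(x_2)\cdots T(x_j)V_{x_j}^{x_+}\big)=e^{i\theta_j(x_1,\dots,x_j)}\qquad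 (x_1,\dots,x_j\in I),$$ and $U$ is diagonal in the position representation: for every $\Psi=(\Psi_j)_{j\ge 0}\in\mathfrak F$ and every $j$, $(U\Psi)_j(x_1,\dots,x_j)=e^{i\theta_j(x_{(1)},\dots,x_{(j)})}\,\Psi_j(x_1,\dots,x_j)$ for almost every $(x_1,\dots,x_j)\in I^j$, where $x_{(1)}\le\dots\le x_{(j)}$ is the increasing rearrangement. -/

import Mathlib

namespace ContinuousMPO

open MeasureTheory

noncomputable section

/-! ### The interval, its configurations and the bosonic Fock space -/

/-- The interval `I` with (possibly infinite) endpoints `a = x₋` and `b = x₊`. -/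
def interval (a b : EReal) : Set ℝ := {x : ℝ | a ≤ (x : EReal) ∧ (x : EReal) ≤ b}

/-- Lebesgue measure on `I ^ N`, as a measure on `Fin N → ℝ`. -/
abbrev configMeasure (a b : EReal) (N : ℕ) : Measure (Fin N → ℝ) :=
  Measure.pi fun _ => volume.restrict (interval a b)

theorem measurePreserving_permute (a b : EReal) (N : ℕ) (σ : Equiv.Perm (Fin N)) :
    MeasurePreserving (fun x : Fin N → ℝ => x ∘ σ) (configMeasure a b N) (configMeasure a b N) := by
  have h := measurePreserving_piCongrLeft
    (fun _ : Fin N => volume.restrict (interval a b)) σ.symm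
  convert h using 1
  funext x i
  have := MeasurableEquiv.piCongrLeft_apply_apply (β := fun _ : Fin N => ℝ) σ.symm x (σ i)
  simpa using this.symm

/-- The action of a permutation of the particles on `L²(I ^ N)`. -/
def permute (a b : EReal) (N : ℕ) (σ : Equiv.Perm (Fin N)) :
    Lp ℂ 2 (configMeasure a b N) →ₗᵢ[ℂ] Lp ℂ 2 (configMeasure a b N) :=
  Lp.compMeasurePreservingₗᵢ ℂ (fun x : Fin N → ℝ => x ∘ σ) (measurePreserving_permute a b N σ)

/-- The `N`-particle sector: the `N`-th symmetric Hilbert power of `L²(I)`, realised as the closed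
subspace of symmetric functions in `L²(I ^ N)`. -/
def sector (a b : EReal) (N : ℕ) : Submodule ℂ (Lp ℂ 2 (configMeasure a b N)) where
  carrier := {f | ∀ σ : Equiv.Perm (Fin N), permute a b N σ f = f}
  add_mem' := fun {f g} hf hg σ => by rw [map_add, hf σ, hg σ]
  zero_mem' := fun σ => map_zero _
  smul_mem' := fun c f hf σ => by rw [map_smul, hf σ]

theorem isClosed_sector (a b : EReal) (N : ℕ) :
    IsClosed (sector a b N : Set (Lp ℂ 2 (configMeasure a b N))) := by
  have h : (sector a b N : Set (Lp ℂ 2 (configMeasure a b N)))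
      = ⋂ σ : Equiv.Perm (Fin N), {f | permute a b N σ f = f} := by
    ext f
    simp [sector]
  rw [h]
  exact isClosed_iInter fun σ => isClosed_eq (permute a b N σ).continuous continuous_id

instance completeSpace_sector (a b : EReal) (N : ℕ) : CompleteSpace (sector a b N) :=
  (isClosed_sector a b N).completeSpace_coe

/-- The bosonic Fock space over `L²(I)`: the Hilbert sum of all `N`-particle sectors. -/
abbrev FockSpace (a b : EReal) : Type := lp (fun N : ℕ => sector a b N) 2

/-- The Fock vector whose only nonzero component is the `N`-particle vector `f`. -/
def inSector {a b : EReal} {N : ℕ} (f : sector a b N) : FockSpace a b :=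
  lp.single 2 N f

/-- The amplitude `⟨Ω| ψ(x_N) ⋯ ψ(x_1) |f⟩ = √(N!) f(x_1, …, x_N)` of an `N`-particle vector. -/
def amplitude {a b : EReal} {N : ℕ} (f : sector a b N) (x : Fin N → ℝ) : ℂ :=
  (Real.sqrt (N.factorial : ℝ) : ℂ) * (f : Lp ℂ 2 (configMeasure a b N)) x

/-! ### Path-ordered exponentials and continuous matrix-product coefficients -/

/-- The oriented integral `∫_s^t f(z) dz` with endpoints that may be infinite. -/
def integralBetween (s t : EReal) (f : ℝ → ℂ) : ℂ :=
  (∫ z in {z : ℝ | s < (z : EReal) ∧ (z : EReal) ≤ t}, f z) -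
    ∫ z in {z : ℝ | t < (z : EReal) ∧ (z : EReal) ≤ s}, f z

/-- The `n`-th term `∫_{s < z_1 < ⋯ < z_n < t} Q(z_1) ⋯ Q(z_n) dz` of the Dyson series
(with the usual orientation when `t < s`); integrals of matrices are taken entrywise. -/
def dysonTerm {D : ℕ} (Q : ℝ → Matrix (Fin D) (Fin D) ℂ) :
    ℕ → EReal → EReal → Matrix (Fin D) (Fin D) ℂ
  | 0, _, _ => 1
  | n + 1, s, t => Matrix.of fun i j =>
      integralBetween s t fun z => (dysonTerm Q n s (z : EReal) * Q z) i j

/-- The free propagator `V_s^t = 𝒫 exp ∫_s^t Q(z) dz`, as a Dyson series; positions increase from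
left to right in products. -/
def propagator {D : ℕ} (Q : ℝ → Matrix (Fin D) (Fin D) ℂ) (s t : EReal) :
    Matrix (Fin D) (Fin D) ℂ :=
  ∑' n : ℕ, dysonTerm Q n s t

/-- The ordered product `V_s^{x_1} K_1 V_{x_1}^{x_2} K_2 ⋯ K_n V_{x_n}^b`. -/
def orderedProduct {D : ℕ} (Q : ℝ → Matrix (Fin D) (Fin D) ℂ) (b : EReal) :
    (n : ℕ) → (Fin n → ℝ) → (Fin n → Matrix (Fin D) (Fin D) ℂ) → EReal →
      Matrix (Fin D) (Fin D) ℂ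
  | 0, _, _, s => propagator Q s b
  | n + 1, x, K, s =>
      propagator Q s (x 0 : EReal) * K 0 *
        orderedProduct Q b n (Fin.tail x) (Fin.tail K) (x 0 : EReal)

/-- The continuous matrix-product coefficient
`Tr (B V_-^{x_1} K_1 V_{x_1}^{x_2} ⋯ K_n V_{x_n}^+)`. -/
def coefficient {D : ℕ} (a b : EReal) (B : Matrix (Fin D) (Fin D) ℂ)
    (Q : ℝ → Matrix (Fin D) (Fin D) ℂ) (n : ℕ) (x : Fin n → ℝ)
    (K : Fin n → Matrix (Fin D) (Fin D) ℂ) : ℂ :=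
  (B * orderedProduct Q b n x K a).trace

/-! ### Continuous matrix product operators -/

/-- The three non-identity supermaps: `l_x[·] = ψ†(x)[·]`, `r_x[·] = [·]ψ(x)` and
`Ad_x[·] = ψ†(x)[·]ψ(x)`. -/
inductive Ladder
  | l
  | r
  | ad
  deriving DecidableEq

instance : Fintype Ladder where
  elems := {.l, .r, .ad}
  complete := fun c => by cases c <;> simp

/-- Whether the supermap puts a creation operator on the left. -/
def Ladder.creates : Ladder → Bool
  | .l => true
  | .r => false
  | .ad => true

/-- Whether the supermap puts an annihilation operator on the right. -/
def Ladder.annihilates : Ladder → Bool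
  | .l => false
  | .r => true
  | .ad => true

/-- The matrix-valued function that multiplies a given supermap. -/
def ladderTensor {D : ℕ} (L R T : ℝ → Matrix (Fin D) (Fin D) ℂ) :
    Ladder → ℝ → Matrix (Fin D) (Fin D) ℂ
  | .l => L
  | .r => R
  | .ad => T

/-- The positions in a word at which a creation operator stands on the left. -/
def creationSites {n : ℕ} (w : Fin n → Ladder) : Finset (Fin n) :=
  Finset.univ.filter fun i => (w i).creates = true

/-- The positions in a word at which an annihilation operator stands on the right. -/
def annihilationSites {n : ℕ} (w : Fin n → Ladder) : Finset (Fin n) :=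
  Finset.univ.filter fun i => (w i).annihilates = true

/-- Words of length `n` in the supermaps whose action on `|Ω⟩⟨Ω|` maps the `N`-particle sector to
the `M`-particle sector. -/
abbrev Word (M N n : ℕ) : Type :=
  {w : Fin n → Ladder // (creationSites w).card = M ∧ (annihilationSites w).card = N}

/-- The integrand, at `x_1 < ⋯ < x_n`, of the contribution of a word `w` to `⟨g| O |f⟩`:
the coefficient `Tr (B V_-^{x_1} K_1(x_1) ⋯ K_n(x_n) V_{x_n}^+)` times
`⟨g| ∏ ψ†(x_i) |Ω⟩ ⟨Ω| ∏ ψ(x_j) |f⟩`, the products running over the positions in `w` that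
carry a creation, respectively an annihilation operator. -/
def wordIntegrand {D : ℕ} {a b : EReal} (B : Matrix (Fin D) (Fin D) ℂ)
    (Q L R T : ℝ → Matrix (Fin D) (Fin D) ℂ) {M N n : ℕ} (w : Word M N n)
    (g : sector a b M) (f : sector a b N) (x : Fin n → ℝ) : ℂ :=
  coefficient a b B Q n x (fun i => ladderTensor L R T (w.1 i) (x i)) *
    starRingEnd ℂ (amplitude g fun i => x ((creationSites w.1).orderEmbOfFin w.2.1 i)) *
    amplitude f fun i => x ((annihilationSites w.1).orderEmbOfFin w.2.2 i)

/-- The bounded operator `U` on Fock space is the continuous matrix product operator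
`Tr_D (B 𝒫 exp ∫_I (Q ⊗ Id + L ⊗ l_x + R ⊗ r_x + T ⊗ Ad_x) dx) (|Ω⟩⟨Ω|)`.
The path-ordered exponential is expanded in the number of insertions of `l`, `r`, `Ad`. Between
an `N`- and an `M`-particle vector only words of length at most `M + N` contribute, so that each
matrix element is a finite sum of integrals over ordered positions. -/
def IsCMPO {D : ℕ} {a b : EReal} (B : Matrix (Fin D) (Fin D) ℂ)
    (Q L R T : ℝ → Matrix (Fin D) (Fin D) ℂ) (U : FockSpace a b →L[ℂ] FockSpace a b) : Prop :=
  ∀ (M N : ℕ) (g : sector a b M) (f : sector a b N),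
    (∀ (n : ℕ) (w : Word M N n),
      IntegrableOn (wordIntegrand B Q L R T w g f) {x | StrictMono x} (configMeasure a b n)) ∧
    inner ℂ (inSector g) (U (inSector f)) =
      ∑ n ∈ Finset.range (M + N + 1), ∑ w : Word M N n,
        ∫ x in {x : Fin n → ℝ | StrictMono x}, wordIntegrand B Q L R T w g f x
          ∂(configMeasure a b n)

/-- `U` is the phase cMPU with tensors `B, Q, T`: it is the cMPO with these tensors and `L = R = 0`,
it is unitary, all its continuous matrix-product coefficients are phases `e^{iθ_j(x_1, …, x_j)}`,
and it is diagonal in the position representation, multiplying the `j`-particle wave function by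
the phase at the increasingly ordered positions. -/
structure IsPhaseCMPU {D : ℕ} {a b : EReal} (B : Matrix (Fin D) (Fin D) ℂ)
    (Q T : ℝ → Matrix (Fin D) (Fin D) ℂ) (U : FockSpace a b →L[ℂ] FockSpace a b) : Prop where
  isCMPO : IsCMPO B Q (fun _ => 0) (fun _ => 0) T U
  unitary : U ∈ unitary (FockSpace a b →L[ℂ] FockSpace a b)
  phases : ∃ θ : (j : ℕ) → (Fin j → ℝ) → ℝ,
    (∀ (j : ℕ) (x : Fin j → ℝ), (∀ i, x i ∈ interval a b) →
      coefficient a b B Q j x (fun i => T (x i)) = Complex.exp (Complex.I * (θ j x : ℂ))) ∧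
    ∀ (Ψ : FockSpace a b) (j : ℕ), ∀ᵐ x ∂(configMeasure a b j),
      (U Ψ j : Lp ℂ 2 (configMeasure a b j)) x =
        Complex.exp (Complex.I * (θ j (x ∘ Tuple.sort x) : ℂ)) *
          (Ψ j : Lp ℂ 2 (configMeasure a b j)) x

/-! ### Generalized permutation matrices and the boundary matrix -/

/-- The group `U(1)^D ⋊ S_D` of generalized permutation matrices
`e^{i diag(t_1, …, t_D)} P`, with real `t_j` and `P` a permutation matrix. -/
def phasePermutations (D : ℕ) : Set (Matrix (Fin D) (Fin D) ℂ) :=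
  {A | ∃ (t : Fin D → ℝ) (σ : Equiv.Perm (Fin D)),
    A = Matrix.diagonal (fun j => Complex.exp (Complex.I * (t j : ℂ))) *
      Equiv.Perm.permMatrix ℂ σ}

/-- The matrix `|k)(+|` with `(+| = (1, 1, …, 1)`. -/
def ketPlus {D : ℕ} (k : Fin D) : Matrix (Fin D) (Fin D) ℂ :=
  Matrix.vecMulVec (Pi.single k 1) fun _ => 1

end

end ContinuousMPO

namespace ContinuousMPO

open MeasureTheory

noncomputable section

/-! ### Powers of a primitive -/

/-! Since `Q` is diagonal, its Dyson series sums entrywise to exponentials of integrals of `i q_j`,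
so every free propagator is a diagonal matrix of phases (`propagator_diagonal`). Such matrices and
the values of `T` have exactly one nonzero entry in each column, a phase, and this property survives
products. With `B = V |k)(+|` the trace is a phase times the sum of column `k` of the ordered
product, hence itself a phase (`norm_coefficient`).

Evaluating the coefficient at the sorted positions gives a symmetric measurable phase function on
each `I ^ N`. Multiplication by it preserves each sector and is inverted by the conjugate phase, so
it is a unitary `fockPhase` on Fock space.

This unitary is the cMPO: with `L = R = 0` only the words made of `Ad` alone contribute, and they
conserve particle number. Their two amplitudes give a factor `N!`, which matches the `N!` orderings
of a configuration (`integral_eq_factorial_mul`). Uniqueness holds because matrix elements between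
vectors of fixed particle number determine a bounded operator. -/

theorem integral_mul_integral_eq_add (ν : Measure ℝ) [SFinite ν] [NullSingletonClass ν]
    {f g : ℝ → ℂ} (hf : Integrable f ν) (hg : Integrable g ν) :
    (∫ z, f z ∂ν) * ∫ w, g w ∂ν =
      (∫ z, f z * ∫ w in Set.Iic z, g w ∂ν ∂ν) + ∫ w, g w * ∫ z in Set.Iic w, f z ∂ν ∂ν := by
  have hfg : Integrable (fun p : ℝ × ℝ => f p.1 * g p.2) (ν.prod ν) := hf.mul_prod hg
  -- Fubini on the two halves of the plane cut by the diagonal; the strict half becomes `Set.Iic`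
  -- because `ν` has no atoms.
  have hS : MeasurableSet {p : ℝ × ℝ | p.2 ≤ p.1} := measurableSet_le measurable_snd measurable_fst
  rw [← integral_prod_mul, ← integral_add_compl hS hfg, ← integral_indicator hS,
    ← integral_indicator hS.compl, integral_prod _ (hfg.indicator hS),
    integral_prod_symm _ (hfg.indicator hS.compl)]
  congr 1
  · refine integral_congr_ae (Filter.Eventually.of_forall fun z => ?_)
    simp only
    rw [← integral_const_mul, ← integral_indicator measurableSet_Iic]
    rfl
  · refine integral_congr_ae (Filter.Eventually.of_forall fun w => ?_)
    simp only
    rw [integral_Iic_eq_integral_Iio, ← integral_const_mul, ← integral_indicator measurableSet_Iio]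
    refine integral_congr_ae (Filter.Eventually.of_forall fun z => ?_)
    simp [Set.indicator_apply, mul_comm]

theorem continuous_integral_Iic (ν : Measure ℝ) [NullSingletonClass ν] {q : ℝ → ℂ}
    (hq : Integrable q ν) : Continuous fun z : ℝ => ∫ w in Set.Iic z, q w ∂ν := by
  have h : (fun z : ℝ => ∫ w in Set.Iic z, q w ∂ν) =
      fun z => (∫ w in Set.Iic 0, q w ∂ν) + ∫ w in (0 : ℝ)..z, q w ∂ν := by
    funext z
    rw [← intervalIntegral.integral_Iic_sub_Iic hq.integrableOn hq.integrableOn]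
    ring
  rw [h]
  exact continuous_const.add
    (intervalIntegral.continuous_primitive (fun _ _ => hq.intervalIntegrable) 0)

theorem integrable_integral_Iic_sub_pow_mul (ν : Measure ℝ) [NullSingletonClass ν] {q : ℝ → ℂ}
    (hq : Integrable q ν) (c : ℂ) (n : ℕ) :
    Integrable (fun z => ((∫ w in Set.Iic z, q w ∂ν) - c) ^ n * q z) ν := by
  refine hq.bdd_mul (c := ((∫ w, ‖q w‖ ∂ν) + ‖c‖) ^ n) ?_ ?_
  · exact (((continuous_integral_Iic ν hq).sub continuous_const).pow n).aestronglyMeasurable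
  · refine Filter.Eventually.of_forall fun z => ?_
    rw [norm_pow]
    refine pow_le_pow_left₀ (norm_nonneg _) ((norm_sub_le _ _).trans ?_) n
    gcongr
    exact (norm_integral_le_integral_norm _).trans
      (setIntegral_le_integral hq.norm (Filter.Eventually.of_forall fun _ => norm_nonneg _))

/-- The chain rule for powers of a primitive `H` of a merely integrable `q`. Induction on the
exponent by integration by parts replaces pointwise differentiation. The shift `c` later becomes the
value of the primitive at the starting point. -/
theorem integral_integral_Iic_sub_pow_mul (ν : Measure ℝ) [SFinite ν] [NullSingletonClass ν]
    {q : ℝ → ℂ} (hq : Integrable q ν) (c : ℂ) (n : ℕ) :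
    ∫ z, ((∫ w in Set.Iic z, q w ∂ν) - c) ^ n * q z ∂ν =
      (((∫ w, q w ∂ν) - c) ^ (n + 1) - (-c) ^ (n + 1)) / (n + 1) := by
  -- The measure varies so that the induction hypothesis also applies to `ν` restricted to `Set.Iic
  -- z`.
  induction n generalizing ν with
  | zero => simp
  | succ n ih =>
    set H : ℝ → ℂ := fun z => ∫ w in Set.Iic z, q w ∂ν with hH
    have hP : ∀ z, ∫ w in Set.Iic z, (H w - c) ^ n * q w ∂ν =
        ((H z - c) ^ (n + 1) - (-c) ^ (n + 1)) / (n + 1) := by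
      intro z
      rw [hH, ← ih (ν.restrict (Set.Iic z)) hq.integrableOn]
      refine setIntegral_congr_fun measurableSet_Iic fun w hw => ?_
      simp only
      rw [Measure.restrict_restrict measurableSet_Iic,
        Set.inter_eq_left.2 (Set.Iic_subset_Iic.2 hw)]
    have hi := integrable_integral_Iic_sub_pow_mul ν hq c n
    have hi' := integrable_integral_Iic_sub_pow_mul ν hq c (n + 1)
    have key := integral_mul_integral_eq_add ν hi hq
    rw [ih ν hq] at key
    -- Splitting `H = (H - c) + c` makes the integral of exponent `n + 1` appear on both sides of
    -- `key`, which is then solved for it.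
    have h1 : ∫ z, (H z - c) ^ n * q z * H z ∂ν =
        (∫ z, (H z - c) ^ (n + 1) * q z ∂ν) + c * ∫ z, (H z - c) ^ n * q z ∂ν := by
      rw [← integral_const_mul, ← integral_add hi' (hi.const_mul c)]
      refine integral_congr_ae (Filter.Eventually.of_forall fun z => ?_)
      simp only
      ring
    have h2 : ∫ w, q w * ∫ z in Set.Iic w, (H z - c) ^ n * q z ∂ν ∂ν =
        ((∫ z, (H z - c) ^ (n + 1) * q z ∂ν) - (-c) ^ (n + 1) * ∫ z, q z ∂ν) / (n + 1) := by
      rw [← integral_const_mul, ← integral_sub hi' (hq.const_mul _), ← integral_div]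
      refine integral_congr_ae (Filter.Eventually.of_forall fun z => ?_)
      simp only [hP]
      ring
    change _ = (∫ z, (H z - c) ^ n * q z * H z ∂ν) +
      ∫ w, q w * ∫ z in Set.Iic w, (H z - c) ^ n * q z ∂ν ∂ν at key
    rw [h1, h2, ih ν hq] at key
    have e1 : (n : ℂ) + 1 ≠ 0 := Nat.cast_add_one_ne_zero n
    have e2 : (n : ℂ) + 1 + 1 ≠ 0 := by exact_mod_cast Nat.succ_ne_zero (n + 1)
    push_cast
    field_simp at key ⊢
    linear_combination -key

/-! ### The free propagator of a diagonal generator -/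

theorem measurableSet_interval (a b : EReal) : MeasurableSet (interval a b) :=
  (measurableSet_le measurable_const measurable_coe_real_ereal).inter
    (measurableSet_le measurable_coe_real_ereal measurable_const)

/-- The primitive `t ↦ ∫_a^t f(z) dz` of a function on `I`. -/
def primitive (a b : EReal) (f : ℝ → ℂ) (t : EReal) : ℂ :=
  ∫ z in {z : ℝ | (z : EReal) ≤ t}, f z ∂(volume.restrict (interval a b))

theorem primitive_coe (a b : EReal) (f : ℝ → ℂ) (t : ℝ) :
    primitive a b f t = ∫ z in Set.Iic t, f z ∂(volume.restrict (interval a b)) := by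
  have : {z : ℝ | (z : EReal) ≤ (t : EReal)} = Set.Iic t := by ext; simp
  rw [primitive, this]

theorem measurableSet_coe_le (t : EReal) : MeasurableSet {z : ℝ | (z : EReal) ≤ t} :=
  measurableSet_le measurable_coe_real_ereal measurable_const

theorem setIntegral_Ioc_eq_primitive_sub {a b s t : EReal} (has : a ≤ s) (hst : s ≤ t)
    (htb : t ≤ b) {f : ℝ → ℂ} (hf : IntegrableOn f (interval a b)) :
    ∫ z in {z : ℝ | s < (z : EReal) ∧ (z : EReal) ≤ t}, f z =
      primitive a b f t - primitive a b f s := by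
  have hd : {z : ℝ | s < (z : EReal) ∧ (z : EReal) ≤ t} =
      {z : ℝ | (z : EReal) ≤ t} \ {z : ℝ | (z : EReal) ≤ s} := by
    ext z; simp [and_comm]
  have hsub : {z : ℝ | s < (z : EReal) ∧ (z : EReal) ≤ t} ⊆ interval a b :=
    fun z hz => ⟨has.trans hz.1.le, hz.2.trans htb⟩
  rw [← Set.inter_eq_left.2 hsub, hd, ← Measure.restrict_restrict
    ((measurableSet_coe_le t).diff (measurableSet_coe_le s)),
    setIntegral_sdiff (measurableSet_coe_le s) (Integrable.integrableOn hf)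
      (show {z : ℝ | (z : EReal) ≤ s} ⊆ {z : ℝ | (z : EReal) ≤ t} from fun z hz => le_trans hz hst)]
  rfl

/-- Covers both orientations at once, which matters because `B` contains the backward propagator
from `b` to `a`. -/
theorem integralBetween_eq_primitive_sub {a b s t : EReal} (hs : s ∈ Set.Icc a b)
    (ht : t ∈ Set.Icc a b) {f : ℝ → ℂ} (hf : IntegrableOn f (interval a b)) :
    integralBetween s t f = primitive a b f t - primitive a b f s := by
  have hempty : ∀ {u v : EReal}, v ≤ u →
      {z : ℝ | u < (z : EReal) ∧ (z : EReal) ≤ v} = ∅ := fun h =>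
    Set.eq_empty_of_forall_notMem fun z hz => (hz.1.trans_le (hz.2.trans h)).false
  rcases le_total s t with h | h
  · rw [integralBetween, hempty h, setIntegral_Ioc_eq_primitive_sub hs.1 h ht.2 hf]
    simp
  · rw [integralBetween, hempty h, setIntegral_Ioc_eq_primitive_sub ht.1 h hs.2 hf]
    simp

theorem integralBetween_congr {a b s t : EReal} (hs : s ∈ Set.Icc a b)
    (ht : t ∈ Set.Icc a b) {f g : ℝ → ℂ} (h : ∀ z ∈ interval a b, f z = g z) :
    integralBetween s t f = integralBetween s t g := by
  have hm : ∀ u v : EReal, MeasurableSet {z : ℝ | u < (z : EReal) ∧ (z : EReal) ≤ v} := fun u v =>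
    (measurableSet_lt measurable_const measurable_coe_real_ereal).inter (measurableSet_coe_le v)
  rw [integralBetween, integralBetween,
    setIntegral_congr_fun (hm s t) fun z hz => h z ⟨hs.1.trans hz.1.le, hz.2.trans ht.2⟩,
    setIntegral_congr_fun (hm t s) fun z hz => h z ⟨ht.1.trans hz.1.le, hz.2.trans hs.2⟩]

theorem integrableOn_primitive_sub_pow_mul {a b : EReal} {q : ℝ → ℂ}
    (hq : IntegrableOn q (interval a b)) (c : ℂ) (n : ℕ) :
    IntegrableOn (fun z : ℝ => (primitive a b q z - c) ^ n * q z) (interval a b) := by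
  simp only [primitive_coe]
  exact integrable_integral_Iic_sub_pow_mul _ hq c n

theorem primitive_primitive_sub_pow_mul {a b : EReal} {q : ℝ → ℂ}
    (hq : IntegrableOn q (interval a b)) (c : ℂ) (n : ℕ) (t : EReal) :
    primitive a b (fun z => (primitive a b q z - c) ^ n * q z) t =
      ((primitive a b q t - c) ^ (n + 1) - (-c) ^ (n + 1)) / (n + 1) := by
  conv_rhs => rw [primitive]
  rw [← integral_integral_Iic_sub_pow_mul _
    (Integrable.integrableOn (s := {z : ℝ | (z : EReal) ≤ t}) hq), primitive]
  refine setIntegral_congr_fun (measurableSet_coe_le t) fun z hz => ?_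
  rw [primitive_coe, Measure.restrict_restrict (μ := volume.restrict (interval a b))
    measurableSet_Iic, Set.inter_eq_left.2 (show Set.Iic z ⊆ {w : ℝ | (w : EReal) ≤ t} from
      fun w hw => (EReal.coe_le_coe_iff.2 hw).trans hz)]

theorem integralBetween_primitive_sub_pow_mul {a b s t : EReal} (hs : s ∈ Set.Icc a b)
    (ht : t ∈ Set.Icc a b) {q : ℝ → ℂ} (hq : IntegrableOn q (interval a b)) (n : ℕ) :
    integralBetween s t (fun z => (primitive a b q z - primitive a b q s) ^ n * q z) =
      (primitive a b q t - primitive a b q s) ^ (n + 1) / (n + 1) := by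
  rw [integralBetween_eq_primitive_sub hs ht (integrableOn_primitive_sub_pow_mul hq _ n),
    primitive_primitive_sub_pow_mul hq, primitive_primitive_sub_pow_mul hq]
  -- With `c` the primitive at `s`, the boundary term at `s` vanishes.
  simp only [sub_self, zero_pow (Nat.succ_ne_zero n)]
  ring

/-- Diagonal matrices commute, so the ordered integral over the simplex is the `n`-th power of a
single integral divided by `n!`. -/
theorem dysonTerm_diagonal {D : ℕ} {a b s t : EReal} (hs : s ∈ Set.Icc a b)
    (ht : t ∈ Set.Icc a b) {p : Fin D → ℝ → ℂ} (hp : ∀ j, IntegrableOn (p j) (interval a b))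
    (n : ℕ) :
    dysonTerm (fun z => Matrix.diagonal fun j => p j z) n s t =
      Matrix.diagonal fun j =>
        (primitive a b (p j) t - primitive a b (p j) s) ^ n / (n.factorial : ℂ) := by
  induction n generalizing t with
  | zero => simp [dysonTerm]
  | succ n ih =>
    ext i j
    -- The identity-matrix entry in the constant treats diagonal and off-diagonal entries together.
    -- The induction hypothesis is available only for `z` in the interval, hence the congruence
    -- there.
    rw [dysonTerm, Matrix.of_apply, integralBetween_congr hs ht (g := fun z =>
      (1 / (n.factorial : ℂ) * Matrix.diagonal (1 : Fin D → ℂ) i j) *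
        ((primitive a b (p j) z - primitive a b (p j) s) ^ n * p j z))]
    · have hmul : ∀ (c : ℂ) (f : ℝ → ℂ),
          integralBetween s t (fun z => c * f z) = c * integralBetween s t f := fun c f => by
        simp only [integralBetween, integral_const_mul, mul_sub]
      rw [hmul, integralBetween_primitive_sub_pow_mul hs ht (hp j), Nat.factorial_succ]
      by_cases h : i = j
      · subst h
        have e1 : (n : ℂ) + 1 ≠ 0 := Nat.cast_add_one_ne_zero n
        simp only [Matrix.diagonal_apply_eq, Pi.one_apply]
        push_cast
        field_simp
      · simp [Matrix.diagonal_apply_ne _ h]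
    · intro z hz
      rw [ih ⟨hz.1, hz.2⟩, Matrix.diagonal_mul_diagonal]
      by_cases h : i = j
      · subst h
        simp only [Matrix.diagonal_apply_eq, Pi.one_apply]
        ring
      · simp [Matrix.diagonal_apply_ne _ h]

theorem propagator_diagonal {D : ℕ} {a b s t : EReal} (hs : s ∈ Set.Icc a b)
    (ht : t ∈ Set.Icc a b) {p : Fin D → ℝ → ℂ} (hp : ∀ j, IntegrableOn (p j) (interval a b)) :
    propagator (fun z => Matrix.diagonal fun j => p j z) s t =
      Matrix.diagonal fun j =>
        Complex.exp (primitive a b (p j) t - primitive a b (p j) s) := by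
  rw [propagator]
  simp only [dysonTerm_diagonal hs ht hp]
  refine HasSum.tsum_eq (HasSum.matrix_diagonal (Pi.hasSum.2 fun j => ?_))
  rw [Complex.exp_eq_exp_ℂ]
  exact NormedSpace.expSeries_div_hasSum_exp _

/-! ### Continuous matrix-product coefficients as phases -/

/-- Every column of the matrix has exactly one nonzero entry, and this entry is a phase. -/
def IsPhaseMonomial {D : ℕ} (A : Matrix (Fin D) (Fin D) ℂ) : Prop :=
  ∀ j, ∃ (i : Fin D) (c : ℂ), ‖c‖ = 1 ∧ A.col j = Pi.single i c

theorem IsPhaseMonomial.mul {D : ℕ} {A A' : Matrix (Fin D) (Fin D) ℂ} (hA : IsPhaseMonomial A)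
    (hA' : IsPhaseMonomial A') : IsPhaseMonomial (A * A') := by
  intro j
  obtain ⟨i, c, hc, h⟩ := hA' j
  obtain ⟨i', c', hc', h'⟩ := hA i
  refine ⟨i', c' * c, by simp [hc, hc'], ?_⟩
  funext l
  have h1 : ∀ m, A' m j = Pi.single (M := fun _ => ℂ) i c m := fun m => congrFun h m
  have h2 : A l i = Pi.single (M := fun _ => ℂ) i' c' l := congrFun h' l
  simp only [Matrix.col_apply, Matrix.mul_apply, h1]
  rw [Finset.sum_eq_single i (fun m _ hm => by simp [hm]) (by simp), h2]
  by_cases hl : l = i' <;> simp [hl]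

theorem isPhaseMonomial_diagonal {D : ℕ} {d : Fin D → ℂ} (hd : ∀ j, ‖d j‖ = 1) :
    IsPhaseMonomial (Matrix.diagonal d) := by
  refine fun j => ⟨j, d j, hd j, ?_⟩
  funext l
  by_cases h : l = j
  · subst h; simp
  · simp [h]

theorem isPhaseMonomial_permMatrix {D : ℕ} (σ : Equiv.Perm (Fin D)) :
    IsPhaseMonomial (Equiv.Perm.permMatrix ℂ σ) := by
  refine fun j => ⟨σ.symm j, 1, norm_one, ?_⟩
  funext l
  simp [Equiv.Perm.permMatrix, PEquiv.toMatrix_apply, Pi.single_apply, Equiv.eq_symm_apply,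
    eq_comm]

theorem isPhaseMonomial_of_mem_phasePermutations {D : ℕ} {A : Matrix (Fin D) (Fin D) ℂ}
    (hA : A ∈ phasePermutations D) : IsPhaseMonomial A := by
  obtain ⟨t, σ, rfl⟩ := hA
  exact (isPhaseMonomial_diagonal fun j => by
    rw [mul_comm, Complex.norm_exp_ofReal_mul_I]).mul (isPhaseMonomial_permMatrix σ)

theorem norm_exp_primitive_sub (a b : EReal) (q : ℝ → ℝ) (s t : EReal) :
    ‖Complex.exp (primitive a b (fun z => Complex.I * (q z : ℂ)) t -
      primitive a b (fun z => Complex.I * (q z : ℂ)) s)‖ = 1 := by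
  simp only [primitive, integral_const_mul, integral_complex_ofReal]
  rw [← mul_sub, ← Complex.ofReal_sub, mul_comm, Complex.norm_exp_ofReal_mul_I]

theorem isPhaseMonomial_propagator {D : ℕ} {a b s t : EReal} (hs : s ∈ Set.Icc a b)
    (ht : t ∈ Set.Icc a b) {q : Fin D → ℝ → ℝ} (hq : ∀ j, IntegrableOn (q j) (interval a b)) :
    IsPhaseMonomial
      (propagator (fun z => Matrix.diagonal fun j => Complex.I * (q j z : ℂ)) s t) := by
  rw [propagator_diagonal hs ht (p := fun j z => Complex.I * (q j z : ℂ))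
    fun j => (Integrable.ofReal (hq j)).const_mul _]
  exact isPhaseMonomial_diagonal fun j => norm_exp_primitive_sub a b (q j) s t

theorem isPhaseMonomial_orderedProduct {D : ℕ} {a b : EReal} {q : Fin D → ℝ → ℝ}
    (hq : ∀ j, IntegrableOn (q j) (interval a b)) (n : ℕ) {x : Fin n → ℝ}
    (hx : ∀ i, x i ∈ interval a b) {K : Fin n → Matrix (Fin D) (Fin D) ℂ}
    (hK : ∀ i, IsPhaseMonomial (K i)) {s : EReal} (hs : s ∈ Set.Icc a b) :
    IsPhaseMonomial
      (orderedProduct (fun z => Matrix.diagonal fun j => Complex.I * (q j z : ℂ)) b n x K s) := by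
  induction n generalizing s with
  | zero => exact isPhaseMonomial_propagator hs ⟨hs.1.trans hs.2, le_rfl⟩ hq
  | succ n ih =>
    exact ((isPhaseMonomial_propagator hs (hx 0) hq).mul (hK 0)).mul
      (ih (fun i => hx i.succ) (fun i => hK i.succ) (hx 0))

/-- `B` has rank one, so the trace collapses to `(+| M |k)` times a scalar. This is why a condition
on columns suffices in `IsPhaseMonomial`. -/
theorem trace_mul_ketPlus_mul {D : ℕ} (d : Fin D → ℂ) (k : Fin D) (M : Matrix (Fin D) (Fin D) ℂ) :
    (Matrix.diagonal d * ketPlus k * M).trace = d k * ∑ i, M i k := by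
  rw [ketPlus, Matrix.mul_vecMulVec, Matrix.vecMulVec_mul, Matrix.trace_vecMulVec]
  have h : (Matrix.diagonal d).mulVec (Pi.single k (1 : ℂ)) = Pi.single k (d k) := by
    funext i
    by_cases hi : i = k
    · subst hi; simp
    · simp [hi]
  rw [h, single_dotProduct]
  simp [Matrix.vecMul, dotProduct]

theorem norm_coefficient {D : ℕ} {a b : EReal} (hab : a ≤ b) {q : Fin D → ℝ → ℝ}
    (hq : ∀ j, IntegrableOn (q j) (interval a b)) (k : Fin D) (n : ℕ) {x : Fin n → ℝ}
    (hx : ∀ i, x i ∈ interval a b) {K : Fin n → Matrix (Fin D) (Fin D) ℂ}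
    (hK : ∀ i, IsPhaseMonomial (K i)) :
    ‖coefficient a b
      (propagator (fun z => Matrix.diagonal fun j => Complex.I * (q j z : ℂ)) b a * ketPlus k)
      (fun z => Matrix.diagonal fun j => Complex.I * (q j z : ℂ)) n x K‖ = 1 := by
  have ha : a ∈ Set.Icc a b := ⟨le_rfl, hab⟩
  obtain ⟨i, c, hc, h⟩ := isPhaseMonomial_orderedProduct hq n hx hK ha k
  rw [coefficient, propagator_diagonal ⟨hab, le_rfl⟩ ha (p := fun j z => Complex.I * (q j z : ℂ))
    fun j => (Integrable.ofReal (hq j)).const_mul _, trace_mul_ketPlus_mul, norm_mul,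
    norm_exp_primitive_sub, one_mul]
  have h1 : ∀ m, orderedProduct (fun z => Matrix.diagonal fun j => Complex.I * (q j z : ℂ))
      b n x K a m k = Pi.single (M := fun _ => ℂ) i c m := fun m => congrFun h m
  simp [h1, hc]

/-! ### Measurability of the coefficients -/

theorem measurable_primitive {a b : EReal} {f : ℝ → ℂ} (hf : IntegrableOn f (interval a b)) :
    Measurable (primitive a b f) := by
  refine EReal.measurable_of_measurable_real ?_
  simp only [primitive_coe]
  exact (continuous_integral_Iic _ hf).measurable

theorem aemeasurable_matrix_mul {α : Type*} [MeasurableSpace α] {μ : Measure α} {D : ℕ}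
    {A A' : α → Matrix (Fin D) (Fin D) ℂ} (hA : ∀ i j, AEMeasurable (fun ω => A ω i j) μ)
    (hA' : ∀ i j, AEMeasurable (fun ω => A' ω i j) μ) (i j : Fin D) :
    AEMeasurable (fun ω => (A ω * A' ω) i j) μ := by
  simp only [Matrix.mul_apply]
  exact Finset.aemeasurable_fun_sum _ fun m _ => (hA i m).mul (hA' m j)

/-- The closed formula for the propagator holds only for endpoints in `[a, b]`, so measurability is
obtained almost everywhere. -/
theorem aemeasurable_propagator {α : Type*} [MeasurableSpace α] {μ : Measure α} {D : ℕ}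
    {a b : EReal} {p : Fin D → ℝ → ℂ} (hp : ∀ j, IntegrableOn (p j) (interval a b))
    {s t : α → EReal} (hs : AEMeasurable s μ) (ht : AEMeasurable t μ)
    (hs' : ∀ᵐ ω ∂μ, s ω ∈ Set.Icc a b) (ht' : ∀ᵐ ω ∂μ, t ω ∈ Set.Icc a b) (i j : Fin D) :
    AEMeasurable
      (fun ω => propagator (fun z => Matrix.diagonal fun j => p j z) (s ω) (t ω) i j) μ := by
  have h : (fun ω => Matrix.diagonal (fun j => Complex.exp
      (primitive a b (p j) (t ω) - primitive a b (p j) (s ω))) i j) =ᵐ[μ]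
      fun ω => propagator (fun z => Matrix.diagonal fun j => p j z) (s ω) (t ω) i j := by
    filter_upwards [hs', ht'] with ω h1 h2
    rw [propagator_diagonal h1 h2 hp]
  refine AEMeasurable.congr ?_ h
  by_cases hij : i = j
  · subst hij
    simp only [Matrix.diagonal_apply_eq]
    exact Complex.measurable_exp.comp_aemeasurable
      (((measurable_primitive (hp i)).comp_aemeasurable ht).sub
        ((measurable_primitive (hp i)).comp_aemeasurable hs))
  · simp only [Matrix.diagonal_apply_ne _ hij]
    exact aemeasurable_const

theorem aemeasurable_orderedProduct {α : Type*} [MeasurableSpace α] {μ : Measure α} {D : ℕ}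
    {a b : EReal} {p : Fin D → ℝ → ℂ} (hp : ∀ j, IntegrableOn (p j) (interval a b)) (n : ℕ)
    {x : α → Fin n → ℝ} (hx : ∀ i, AEMeasurable (fun ω => x ω i) μ)
    (hx' : ∀ i, ∀ᵐ ω ∂μ, x ω i ∈ interval a b) {K : α → Fin n → Matrix (Fin D) (Fin D) ℂ}
    (hK : ∀ l i j, AEMeasurable (fun ω => K ω l i j) μ) {s : α → EReal} (hs : AEMeasurable s μ)
    (hs' : ∀ᵐ ω ∂μ, s ω ∈ Set.Icc a b) (i j : Fin D) :
    AEMeasurable (fun ω => orderedProduct (fun z => Matrix.diagonal fun j => p j z) b n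
      (x ω) (K ω) (s ω) i j) μ := by
  induction n generalizing s i j with
  | zero =>
    exact aemeasurable_propagator hp hs aemeasurable_const hs'
      (hs'.mono fun ω h => ⟨h.1.trans h.2, le_rfl⟩) i j
  | succ n ih =>
    have h0 : AEMeasurable (fun ω => (x ω 0 : EReal)) μ :=
      measurable_coe_real_ereal.comp_aemeasurable (hx 0)
    exact aemeasurable_matrix_mul
      (aemeasurable_matrix_mul (aemeasurable_propagator hp hs h0 hs' (hx' 0)) (hK 0))
      (ih (x := fun ω => Fin.tail (x ω)) (fun i => hx i.succ) (fun i => hx' i.succ)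
        (K := fun ω => Fin.tail (K ω)) (fun l => hK l.succ) h0 (hx' 0)) i j

theorem ae_mem_interval (a b : EReal) (n : ℕ) :
    ∀ᵐ x ∂(configMeasure a b n), ∀ i, x i ∈ interval a b :=
  ae_all_iff.2 fun i =>
    (Measure.quasiMeasurePreserving_eval (fun _ : Fin n => volume.restrict (interval a b)) i).ae
      (ae_restrict_mem (measurableSet_interval a b))

theorem aemeasurable_coefficient {D : ℕ} {a b : EReal} (hab : a ≤ b) {p : Fin D → ℝ → ℂ}
    (hp : ∀ j, IntegrableOn (p j) (interval a b)) (B : Matrix (Fin D) (Fin D) ℂ) (n : ℕ)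
    {T : ℝ → Matrix (Fin D) (Fin D) ℂ}
    (hT : ∀ i j, AEMeasurable (fun x => T x i j) (volume.restrict (interval a b))) :
    AEMeasurable (fun x => coefficient a b B (fun z => Matrix.diagonal fun j => p j z) n x
      fun i => T (x i)) (configMeasure a b n) := by
  have hO : ∀ i j, AEMeasurable (fun x : Fin n → ℝ => orderedProduct
      (fun z => Matrix.diagonal fun j => p j z) b n x (fun i => T (x i)) a i j)
      (configMeasure a b n) := by
    have hK : ∀ l i j, AEMeasurable (fun x : Fin n → ℝ => T (x l) i j) (configMeasure a b n) :=
      fun l i j => (hT i j).comp_quasiMeasurePreserving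
        (Measure.quasiMeasurePreserving_eval (fun _ : Fin n => volume.restrict (interval a b)) l)
    exact aemeasurable_orderedProduct hp n (x := fun x => x)
      (fun i => (measurable_pi_apply i).aemeasurable) (ae_all_iff.1 (ae_mem_interval a b n))
      (K := fun x l => T (x l)) hK (s := fun _ => a)
      aemeasurable_const (Filter.Eventually.of_forall fun _ => ⟨le_rfl, hab⟩)
  exact Finset.aemeasurable_fun_sum Finset.univ fun i _ =>
    aemeasurable_matrix_mul (A := fun _ => B) (fun _ _ => aemeasurable_const) hO i i

/-! ### Multiplication by a phase -/

section PhaseMul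

variable {α : Type*} [MeasurableSpace α] {μ : Measure α}

/-- An almost everywhere measurable function with values in the unit circle. -/
structure IsPhaseFunction (u : α → ℂ) (μ : Measure α) : Prop where
  aestronglyMeasurable : AEStronglyMeasurable u μ
  norm_eq_one : ∀ᵐ x ∂μ, ‖u x‖ = 1

theorem IsPhaseFunction.star {u : α → ℂ} (hu : IsPhaseFunction u μ) :
    IsPhaseFunction (fun x => starRingEnd ℂ (u x)) μ :=
  ⟨Complex.continuous_conj.comp_aestronglyMeasurable hu.1, hu.2.mono fun x h => by simp [h]⟩

theorem IsPhaseFunction.memLp_mul {u : α → ℂ} (hu : IsPhaseFunction u μ) (f : Lp ℂ 2 μ) :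
    MemLp (fun x => u x * f x) 2 μ :=
  (Lp.memLp f).congr_norm (hu.1.mul (Lp.aestronglyMeasurable f))
    (hu.2.mono fun x h => by simp [h])

/-- Multiplication by a phase on `L²`. -/
def phaseMul (u : α → ℂ) (hu : IsPhaseFunction u μ) : Lp ℂ 2 μ →ₗᵢ[ℂ] Lp ℂ 2 μ where
  toFun f := (hu.memLp_mul f).toLp
  map_add' f g := by
    rw [← MemLp.toLp_add]
    refine MemLp.toLp_congr _ _ ?_
    filter_upwards [Lp.coeFn_add f g] with x hx
    exact (congrArg (u x * ·) hx).trans (mul_add _ _ _)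
  map_smul' c f := by
    rw [RingHom.id_apply, ← MemLp.toLp_const_smul]
    refine MemLp.toLp_congr _ _ ?_
    filter_upwards [Lp.coeFn_smul c f] with x hx
    simp [hx, mul_left_comm]
  norm_map' f := by
    change ‖(hu.memLp_mul f).toLp‖ = ‖f‖
    rw [Lp.norm_toLp, Lp.norm_def]
    congr 1
    exact eLpNorm_congr_norm_ae (hu.2.mono fun x h => by simp [h])

theorem coeFn_phaseMul {u : α → ℂ} (hu : IsPhaseFunction u μ) (f : Lp ℂ 2 μ) :
    phaseMul u hu f =ᵐ[μ] fun x => u x * f x :=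
  (hu.memLp_mul f).coeFn_toLp

theorem inner_phaseMul {u : α → ℂ} (hu : IsPhaseFunction u μ) (g f : Lp ℂ 2 μ) :
    inner ℂ g (phaseMul u hu f) = ∫ x, u x * (starRingEnd ℂ (g x) * f x) ∂μ := by
  rw [L2.inner_def]
  refine integral_congr_ae ?_
  filter_upwards [coeFn_phaseMul hu f] with x hx
  rw [hx, RCLike.inner_apply]
  ring

theorem inner_phaseMul_star {u : α → ℂ} (hu : IsPhaseFunction u μ) (g f : Lp ℂ 2 μ) :
    inner ℂ (phaseMul (fun x => starRingEnd ℂ (u x)) hu.star g) f =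
      inner ℂ g (phaseMul u hu f) := by
  rw [inner_phaseMul, L2.inner_def]
  refine integral_congr_ae ?_
  filter_upwards [coeFn_phaseMul hu.star g] with x hx
  rw [hx, RCLike.inner_apply, map_mul, Complex.conj_conj]
  ring

theorem phaseMul_star_phaseMul {u : α → ℂ} (hu : IsPhaseFunction u μ) (f : Lp ℂ 2 μ) :
    phaseMul (fun x => starRingEnd ℂ (u x)) hu.star (phaseMul u hu f) = f := by
  refine Lp.ext ?_
  filter_upwards [coeFn_phaseMul hu.star (phaseMul u hu f), coeFn_phaseMul hu f, hu.2]
    with x h1 h2 h3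
  rw [h1, h2, ← mul_assoc, mul_comm (starRingEnd ℂ (u x)), Complex.mul_conj,
    Complex.normSq_eq_norm_sq, h3]
  simp

theorem phaseMul_phaseMul_star {u : α → ℂ} (hu : IsPhaseFunction u μ) (f : Lp ℂ 2 μ) :
    phaseMul u hu (phaseMul (fun x => starRingEnd ℂ (u x)) hu.star f) = f := by
  refine Lp.ext ?_
  filter_upwards [coeFn_phaseMul hu (phaseMul _ hu.star f), coeFn_phaseMul hu.star f, hu.2]
    with x h1 h2 h3
  rw [h1, h2, ← mul_assoc, Complex.mul_conj, Complex.normSq_eq_norm_sq, h3]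
  simp

end PhaseMul

/-! ### Phases on the sectors and on Fock space -/

variable {a b : EReal}

theorem coeFn_comp_perm {N : ℕ} (f : sector a b N) (σ : Equiv.Perm (Fin N)) :
    (fun x : Fin N → ℝ => (f : Lp ℂ 2 (configMeasure a b N)) (x ∘ σ)) =ᵐ[configMeasure a b N]
      (f : Lp ℂ 2 (configMeasure a b N)) := by
  have h := Lp.coeFn_compMeasurePreserving (f : Lp ℂ 2 (configMeasure a b N))
    (measurePreserving_permute a b N σ)
  have h' : Lp.compMeasurePreserving _ (measurePreserving_permute a b N σ)
    (f : Lp ℂ 2 (configMeasure a b N)) = f := f.2 σ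
  rw [h'] at h
  exact h.symm

/-- A symmetric phase function on each `I ^ N`. -/
structure IsSymmetricPhase (u : (N : ℕ) → (Fin N → ℝ) → ℂ) (a b : EReal) : Prop where
  isPhaseFunction : ∀ N, IsPhaseFunction (u N) (configMeasure a b N)
  comp_perm : ∀ N (x : Fin N → ℝ) (σ : Equiv.Perm (Fin N)), u N (x ∘ σ) = u N x

theorem IsSymmetricPhase.star {u : (N : ℕ) → (Fin N → ℝ) → ℂ} (hu : IsSymmetricPhase u a b) :
    IsSymmetricPhase (fun N x => starRingEnd ℂ (u N x)) a b :=
  ⟨fun N => (hu.1 N).star, fun N x σ => by rw [hu.2]⟩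

theorem IsSymmetricPhase.phaseMul_mem_sector {u : (N : ℕ) → (Fin N → ℝ) → ℂ}
    (hu : IsSymmetricPhase u a b) {N : ℕ} (f : sector a b N) :
    phaseMul (u N) (hu.1 N) f ∈ sector a b N := by
  intro σ
  refine Lp.ext ?_
  have h1 := coeFn_phaseMul (hu.1 N) (f : Lp ℂ 2 (configMeasure a b N))
  have h2 := (measurePreserving_permute a b N σ).quasiMeasurePreserving.ae_eq_comp h1
  have h3 := Lp.coeFn_compMeasurePreserving (phaseMul (u N) (hu.1 N) f)
    (measurePreserving_permute a b N σ)
  filter_upwards [h1, h2, h3, coeFn_comp_perm f σ] with x e1 e2 e3 e4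
  refine e3.trans (e2.trans ?_)
  rw [e1]
  simp only [Function.comp_apply]
  rw [e4, hu.2]

/-- Multiplication by a symmetric phase on the `N`-particle sector. -/
def sectorPhase (u : (N : ℕ) → (Fin N → ℝ) → ℂ) (hu : IsSymmetricPhase u a b) (N : ℕ) :
    sector a b N →L[ℂ] sector a b N :=
  ((phaseMul (u N) (hu.1 N)).toContinuousLinearMap.comp (sector a b N).subtypeL).codRestrict
    (sector a b N) fun f => hu.phaseMul_mem_sector f

theorem coe_sectorPhase {u : (N : ℕ) → (Fin N → ℝ) → ℂ} (hu : IsSymmetricPhase u a b) {N : ℕ}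
    (f : sector a b N) :
    (sectorPhase u hu N f : Lp ℂ 2 (configMeasure a b N)) = phaseMul (u N) (hu.1 N) f := rfl

theorem norm_sectorPhase_le {u : (N : ℕ) → (Fin N → ℝ) → ℂ} (hu : IsSymmetricPhase u a b)
    (N : ℕ) : ‖sectorPhase u hu N‖ ≤ 1 :=
  ContinuousLinearMap.opNorm_le_bound _ zero_le_one fun f => by
    rw [one_mul, Submodule.coe_norm, coe_sectorPhase, LinearIsometry.norm_map, Submodule.coe_norm]

/-- Multiplication by a symmetric phase on Fock space. -/
def fockPhase (u : (N : ℕ) → (Fin N → ℝ) → ℂ) (hu : IsSymmetricPhase u a b) :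
    FockSpace a b →L[ℂ] FockSpace a b :=
  lp.mapCLM 2 (sectorPhase u hu) zero_le_one (norm_sectorPhase_le hu)

theorem fockPhase_apply {u : (N : ℕ) → (Fin N → ℝ) → ℂ} (hu : IsSymmetricPhase u a b)
    (Ψ : FockSpace a b) (N : ℕ) : fockPhase u hu Ψ N = sectorPhase u hu N (Ψ N) := rfl

theorem adjoint_fockPhase {u : (N : ℕ) → (Fin N → ℝ) → ℂ} (hu : IsSymmetricPhase u a b) :
    star (fockPhase u hu) = fockPhase (fun N x => starRingEnd ℂ (u N x)) hu.star := by
  rw [ContinuousLinearMap.star_eq_adjoint, eq_comm, ContinuousLinearMap.eq_adjoint_iff]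
  intro Ψ Φ
  rw [lp.inner_eq_tsum, lp.inner_eq_tsum]
  refine tsum_congr fun N => ?_
  rw [fockPhase_apply, fockPhase_apply, Submodule.coe_inner, Submodule.coe_inner]
  exact inner_phaseMul_star (hu.1 N) _ _

theorem fockPhase_mem_unitary {u : (N : ℕ) → (Fin N → ℝ) → ℂ} (hu : IsSymmetricPhase u a b) :
    fockPhase u hu ∈ unitary (FockSpace a b →L[ℂ] FockSpace a b) := by
  rw [Unitary.mem_iff, adjoint_fockPhase]
  refine ⟨ContinuousLinearMap.ext fun Ψ => lp.ext <| funext fun N => Subtype.ext ?_,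
    ContinuousLinearMap.ext fun Ψ => lp.ext <| funext fun N => Subtype.ext ?_⟩
  · exact phaseMul_star_phaseMul (hu.1 N) _
  · exact phaseMul_phaseMul_star (hu.1 N) _

theorem inner_inSector_of_ne {M N : ℕ} (h : M ≠ N) (g : sector a b M) (f : sector a b N)
    {u : (N : ℕ) → (Fin N → ℝ) → ℂ} (hu : IsSymmetricPhase u a b) :
    inner ℂ (inSector g) (fockPhase u hu (inSector f)) = 0 := by
  rw [inSector, lp.inner_single_left, fockPhase_apply, inSector, lp.single_apply_ne _ _ _ h,
    map_zero, inner_zero_right]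

theorem inner_inSector_fockPhase {N : ℕ} (g f : sector a b N) {u : (N : ℕ) → (Fin N → ℝ) → ℂ}
    (hu : IsSymmetricPhase u a b) :
    inner ℂ (inSector g) (fockPhase u hu (inSector f)) =
      ∫ x, u N x * (starRingEnd ℂ ((g : Lp ℂ 2 (configMeasure a b N)) x) *
        (f : Lp ℂ 2 (configMeasure a b N)) x) ∂(configMeasure a b N) := by
  rw [inSector, lp.inner_single_left, fockPhase_apply, inSector, lp.single_apply_self,
    Submodule.coe_inner, coe_sectorPhase, inner_phaseMul]

/-- Vectors supported in one sector span a dense subspace, so a bounded operator is determined by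
its values on them, and each value by its sector components. -/
theorem eq_of_inner_inSector {U U' : FockSpace a b →L[ℂ] FockSpace a b}
    (h : ∀ (M N : ℕ) (g : sector a b M) (f : sector a b N),
      inner ℂ (inSector g) (U (inSector f)) = inner ℂ (inSector g) (U' (inSector f))) :
    U = U' := by
  refine lp.ext_continuousLinearMap ENNReal.ofNat_ne_top fun N => ContinuousLinearMap.ext fun f =>
    lp.ext <| funext fun M => ext_inner_left ℂ fun g => ?_
  have := h M N g f
  rwa [inSector, lp.inner_single_left, lp.inner_single_left] at this

/-! ### Integrals of symmetric functions over ordered configurations -/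

/-- Relabelling of the particles. -/
def permuteEquiv {N : ℕ} (σ : Equiv.Perm (Fin N)) : (Fin N → ℝ) ≃ᵐ (Fin N → ℝ) where
  toFun x := x ∘ σ
  invFun x := x ∘ σ.symm
  left_inv x := by funext i; simp
  right_inv x := by funext i; simp
  measurable_toFun := measurable_pi_lambda _ fun i => measurable_pi_apply (σ i)
  measurable_invFun := measurable_pi_lambda _ fun i => measurable_pi_apply (σ.symm i)

theorem measurableSet_strictMono (N : ℕ) : MeasurableSet {x : Fin N → ℝ | StrictMono x} := by
  simp only [StrictMono, Set.ofPred_forall]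
  exact MeasurableSet.iInter fun i => MeasurableSet.iInter fun j => MeasurableSet.iInter fun _ =>
    measurableSet_lt (measurable_pi_apply i) (measurable_pi_apply j)

/-- Coinciding particles lie on one of finitely many hyperplanes `x i = x j`, each a proper subspace
and so Lebesgue null. -/
theorem ae_injective (a b : EReal) (N : ℕ) :
    ∀ᵐ x ∂(configMeasure a b N), Function.Injective x := by
  have hac : configMeasure a b N ≪ volume := by
    rw [configMeasure, ← Measure.restrict_pi_pi]
    exact Measure.absolutelyContinuous_of_le Measure.restrict_le_self
  refine hac.ae_le ?_
  have h : ∀ i j : Fin N, ∀ᵐ x : Fin N → ℝ, x i = x j → i = j := by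
    intro i j
    by_cases hij : i = j
    · exact Filter.Eventually.of_forall fun _ _ => hij
    · have h0 := Measure.addHaar_submodule (volume : Measure (Fin N → ℝ))
        (LinearMap.ker (LinearMap.proj (R := ℝ) (φ := fun _ : Fin N => ℝ) i - LinearMap.proj j))
        (fun h => by
          have h1 : Pi.single (M := fun _ => ℝ) i 1 ∈ LinearMap.ker
            (LinearMap.proj (R := ℝ) (φ := fun _ : Fin N => ℝ) i - LinearMap.proj j) := by
            rw [h]; trivial
          simp [Ne.symm hij] at h1)
      refine measure_mono_null (fun x hx => ?_) h0
      simp only [Set.mem_compl_iff, Set.mem_ofPred_eq, Classical.not_imp] at hx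
      simp [hx.1]
  filter_upwards [ae_all_iff.2 fun i => ae_all_iff.2 (h i)] with x hx i j hij using hx i j hij

/-- The `N!` chambers, one for each ordering of the coordinates, are disjoint and cover almost
everything; relabelling carries each to the increasing chamber without changing the integral. -/
theorem integral_eq_factorial_mul {N : ℕ} {F : (Fin N → ℝ) → ℂ}
    (hF : Integrable F (configMeasure a b N))
    (hsymm : ∀ σ : Equiv.Perm (Fin N), (fun x => F (x ∘ σ)) =ᵐ[configMeasure a b N] F) :
    ∫ x, F x ∂(configMeasure a b N) =
      (N.factorial : ℂ) * ∫ x in {x : Fin N → ℝ | StrictMono x}, F x ∂(configMeasure a b N) := by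
  set S : Equiv.Perm (Fin N) → Set (Fin N → ℝ) := fun σ => {x | StrictMono (x ∘ σ)} with hS
  have hSm : ∀ σ, MeasurableSet (S σ) := fun σ =>
    (permuteEquiv σ).measurable (measurableSet_strictMono N)
  have hdisj : Pairwise (Function.onFun Disjoint S) := by
    intro σ τ hστ
    refine Set.disjoint_left.2 fun x hσ hτ => hστ ?_
    have he : x ∘ σ = x ∘ τ :=
      Tuple.unique_monotone (StrictMono.monotone hσ) (StrictMono.monotone hτ)
    have hinj : Function.Injective x := by
      have h := (StrictMono.injective hσ).comp σ.symm.injective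
      rwa [Function.comp_assoc, Equiv.self_comp_symm, Function.comp_id] at h
    exact Equiv.ext fun i => hinj (congrFun he i)
  have hcov : (⋃ σ, S σ) =ᵐ[configMeasure a b N] Set.univ := by
    refine Filter.eventuallyEq_univ.2 ?_
    filter_upwards [ae_injective a b N] with x hx
    exact Set.mem_iUnion.2 ⟨Tuple.sort x, (Tuple.monotone_sort x).strictMono_of_injective
      (hx.comp (Tuple.sort x).injective)⟩
  have hpiece : ∀ σ, ∫ x in S σ, F x ∂(configMeasure a b N) =
      ∫ x in {x : Fin N → ℝ | StrictMono x}, F x ∂(configMeasure a b N) := fun σ => by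
    rw [← (measurePreserving_permute a b N σ).setIntegral_preimage_emb
      (permuteEquiv σ).measurableEmbedding F {x | StrictMono x}]
    exact integral_congr_ae (ae_restrict_of_ae (hsymm σ).symm)
  rw [← setIntegral_univ, ← setIntegral_congr_set hcov,
    integral_iUnion_fintype hSm hdisj fun σ => hF.integrableOn]
  simp only [hpiece, Finset.sum_const, Finset.card_univ, Fintype.card_perm, Fintype.card_fin,
    nsmul_eq_mul]

/-! ### The phase at the increasing rearrangement -/

theorem measurableSet_sort_eq {N : ℕ} (σ : Equiv.Perm (Fin N)) :
    MeasurableSet {x : Fin N → ℝ | Tuple.sort x = σ} := by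
  have h : {x : Fin N → ℝ | Tuple.sort x = σ} =
      {x | ∀ i j, i ≤ j → x (σ i) ≤ x (σ j)} ∩
        -- `Tuple.sort` breaks ties by index, so this second condition is needed to single out `σ`
        -- on the diagonals.
        {x | ∀ i j, i < j → x (σ i) = x (σ j) → σ i < σ j} := by
    ext x
    rw [Set.mem_ofPred_eq, eq_comm, Tuple.eq_sort_iff]
    rfl
  rw [h]
  refine MeasurableSet.inter ?_ ?_
  · simp only [Set.ofPred_forall]
    exact MeasurableSet.iInter fun i => MeasurableSet.iInter fun j => MeasurableSet.iInter fun _ =>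
      measurableSet_le (measurable_pi_apply _) (measurable_pi_apply _)
  · simp only [Set.ofPred_forall]
    exact MeasurableSet.iInter fun i => MeasurableSet.iInter fun j => MeasurableSet.iInter fun _ =>
      MeasurableSet.imp (measurableSet_eq_fun (measurable_pi_apply _) (measurable_pi_apply _))
        (MeasurableSet.const _)

/-- Where the sorting permutation is a fixed `σ`, the function is `φ N` after a measure-preserving
relabelling; finitely many such measurable pieces cover the space. Symmetry is exact, since
permuting a tuple does not change its sorted form. -/
theorem isSymmetricPhase_comp_sort {φ : (N : ℕ) → (Fin N → ℝ) → ℂ}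
    (hm : ∀ N, AEMeasurable (φ N) (configMeasure a b N))
    (hn : ∀ N (x : Fin N → ℝ), (∀ i, x i ∈ interval a b) → ‖φ N x‖ = 1) :
    IsSymmetricPhase (fun N x => φ N (x ∘ Tuple.sort x)) a b where
  isPhaseFunction N := by
    refine ⟨AEMeasurable.aestronglyMeasurable ?_, ?_⟩
    · have hcov : (⋃ σ : Equiv.Perm (Fin N), {x : Fin N → ℝ | Tuple.sort x = σ}) = Set.univ :=
        Set.eq_univ_of_forall fun x => Set.mem_iUnion.2 ⟨Tuple.sort x, rfl⟩
      rw [← Measure.restrict_univ (μ := configMeasure a b N), ← hcov, aemeasurable_iUnion_iff]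
      intro σ
      refine ((hm N).comp_quasiMeasurePreserving
        (measurePreserving_permute a b N σ).quasiMeasurePreserving).restrict.congr ?_
      filter_upwards [ae_restrict_mem (measurableSet_sort_eq σ)] with x hx
      exact congrArg (fun τ : Equiv.Perm (Fin N) => φ N (x ∘ τ)) (Eq.symm hx)
    · filter_upwards [ae_mem_interval a b N] with x hx using hn N _ fun i => hx _
  comp_perm N x σ := by rw [Tuple.comp_perm_comp_sort_eq_comp_sort]

/-! ### Matrix elements of a cMPO with `L = R = 0` -/

theorem orderedProduct_eq_zero {D : ℕ} (Q : ℝ → Matrix (Fin D) (Fin D) ℂ) (b : EReal) {n : ℕ}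
    (x : Fin n → ℝ) (K : Fin n → Matrix (Fin D) (Fin D) ℂ) {i : Fin n} (hK : K i = 0)
    (s : EReal) : orderedProduct Q b n x K s = 0 := by
  induction n generalizing s with
  | zero => exact i.elim0
  | succ n ih =>
    rw [orderedProduct]
    refine Fin.cases (fun h => ?_) (fun i h => ?_) i hK
    · rw [h, mul_zero, zero_mul]
    · rw [ih (Fin.tail x) (Fin.tail K) (i := i) h, mul_zero]

theorem wordIntegrand_eq_zero {D : ℕ} {a b : EReal} (B : Matrix (Fin D) (Fin D) ℂ)
    (Q T : ℝ → Matrix (Fin D) (Fin D) ℂ) {M N n : ℕ} (w : Word M N n) {i : Fin n}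
    (hw : w.1 i ≠ Ladder.ad) (g : sector a b M) (f : sector a b N) :
    wordIntegrand B Q (fun _ => 0) (fun _ => 0) T w g f = 0 := by
  funext x
  have hK : ladderTensor (fun _ => 0) (fun _ => 0) T (w.1 i) (x i) = 0 := by
    cases h : w.1 i with
    | l => rfl
    | r => rfl
    | ad => exact absurd h hw
  rw [wordIntegrand, coefficient,
    orderedProduct_eq_zero (K := fun i => ladderTensor (fun _ => 0) (fun _ => 0) T (w.1 i) (x i))
      Q b x hK a]
  simp

theorem Word.card_eq_of_forall_eq_ad {M N n : ℕ} (w : Word M N n)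
    (hw : ∀ i, w.1 i = Ladder.ad) : n = M ∧ n = N := by
  have h1 := w.2.1
  have h2 := w.2.2
  simp only [creationSites, annihilationSites, hw, Ladder.creates, Ladder.annihilates,
    Finset.filter_true, Finset.card_univ, Fintype.card_fin] at h1 h2
  exact ⟨h1, h2⟩

/-- The word consisting of `N` letters `Ad`. -/
def adWord (N : ℕ) : Word N N N :=
  ⟨fun _ => Ladder.ad, by simp [creationSites, Ladder.creates],
    by simp [annihilationSites, Ladder.annihilates]⟩

theorem orderEmbOfFin_self {N : ℕ} (s : Finset (Fin N)) (h : s.card = N) (i : Fin N) :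
    s.orderEmbOfFin h i = i := by
  have hs : s = Finset.univ := Finset.eq_univ_of_card s (by simpa using h)
  have := Finset.orderEmbOfFin_unique' h (f := RelEmbedding.refl _) fun i => by simp [hs]
  rw [← this]
  rfl

theorem wordIntegrand_adWord {D : ℕ} {a b : EReal} (B : Matrix (Fin D) (Fin D) ℂ)
    (Q L R T : ℝ → Matrix (Fin D) (Fin D) ℂ) {N : ℕ} (g f : sector a b N) (x : Fin N → ℝ) :
    wordIntegrand B Q L R T (adWord N) g f x =
      (N.factorial : ℂ) * (coefficient a b B Q N x (fun i => T (x i)) *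
        (starRingEnd ℂ ((g : Lp ℂ 2 (configMeasure a b N)) x) *
          (f : Lp ℂ 2 (configMeasure a b N)) x)) := by
  -- Each of the two amplitudes carries one factor `√(N!)`.
  have hs : (Real.sqrt (N.factorial : ℝ) : ℂ) * (Real.sqrt (N.factorial : ℝ) : ℂ) =
      (N.factorial : ℂ) := by
    rw [← Complex.ofReal_mul, Real.mul_self_sqrt (Nat.cast_nonneg _), Complex.ofReal_natCast]
  simp only [wordIntegrand, orderEmbOfFin_self, amplitude, map_mul, Complex.conj_ofReal]
  change coefficient a b B Q N x (fun i => T (x i)) * _ * _ = _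
  rw [← hs]
  ring

theorem IsSymmetricPhase.integrable {a b : EReal} {u : (N : ℕ) → (Fin N → ℝ) → ℂ}
    (hu : IsSymmetricPhase u a b) {N : ℕ} (g f : sector a b N) :
    Integrable (fun x => u N x * (starRingEnd ℂ ((g : Lp ℂ 2 (configMeasure a b N)) x) *
        (f : Lp ℂ 2 (configMeasure a b N)) x)) (configMeasure a b N) := by
  have h := L2.integrable_inner (𝕜 := ℂ) (g : Lp ℂ 2 (configMeasure a b N)) f
  refine Integrable.bdd_mul (c := 1) (h.congr ?_) (hu.1 N).1 ((hu.1 N).2.mono fun x h => h.le)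
  exact Filter.Eventually.of_forall fun x => by simp only [RCLike.inner_apply]; ring

theorem integral_eq_factorial_mul_of_isSymmetricPhase {a b : EReal}
    {u : (N : ℕ) → (Fin N → ℝ) → ℂ} (hu : IsSymmetricPhase u a b) {N : ℕ} (g f : sector a b N) :
    ∫ x, u N x * (starRingEnd ℂ ((g : Lp ℂ 2 (configMeasure a b N)) x) *
        (f : Lp ℂ 2 (configMeasure a b N)) x) ∂(configMeasure a b N) =
      (N.factorial : ℂ) * ∫ x in {x : Fin N → ℝ | StrictMono x},
        u N x * (starRingEnd ℂ ((g : Lp ℂ 2 (configMeasure a b N)) x) *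
          (f : Lp ℂ 2 (configMeasure a b N)) x) ∂(configMeasure a b N) := by
  refine integral_eq_factorial_mul (hu.integrable g f) fun σ => ?_
  filter_upwards [coeFn_comp_perm g σ, coeFn_comp_perm f σ] with x h1 h2
  rw [hu.2, h1, h2]

theorem isCMPO_fockPhase {D : ℕ} {a b : EReal} (B : Matrix (Fin D) (Fin D) ℂ)
    (Q T : ℝ → Matrix (Fin D) (Fin D) ℂ)
    (hu : IsSymmetricPhase (fun N x => coefficient a b B Q N (x ∘ Tuple.sort x)
      fun i => T ((x ∘ Tuple.sort x) i)) a b) :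
    IsCMPO B Q (fun _ => 0) (fun _ => 0) T (fockPhase _ hu) := by
  have had : ∀ (N : ℕ) (g f : sector a b N) (x : Fin N → ℝ), x ∈ {x : Fin N → ℝ | StrictMono x} →
      (N.factorial : ℂ) * (coefficient a b B Q N (x ∘ Tuple.sort x)
        (fun i => T ((x ∘ Tuple.sort x) i)) *
        (starRingEnd ℂ ((g : Lp ℂ 2 (configMeasure a b N)) x) *
          (f : Lp ℂ 2 (configMeasure a b N)) x)) =
      wordIntegrand B Q (fun _ => 0) (fun _ => 0) T (adWord N) g f x := by
    intro N g f x hx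
    -- On increasing configurations sorting is the identity, so the symmetrised phase agrees with
    -- the bare coefficient.
    rw [wordIntegrand_adWord, Tuple.sort_eq_refl_iff_monotone.2 (StrictMono.monotone hx)]
    rfl
  intro M N g f
  refine ⟨fun n w => ?_, ?_⟩
  · by_cases hw : ∀ i, w.1 i = Ladder.ad
    · obtain ⟨rfl, rfl⟩ := w.card_eq_of_forall_eq_ad hw
      obtain rfl : w = adWord n := Subtype.ext (funext hw)
      exact ((hu.integrable g f).const_mul _).integrableOn.congr_fun (had n g f)
        (measurableSet_strictMono n)
    · obtain ⟨i, hi⟩ := not_forall.1 hw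
      rw [wordIntegrand_eq_zero B Q T w hi]
      exact integrableOn_zero
  · by_cases hMN : M = N
    · subst hMN
      rw [inner_inSector_fockPhase, integral_eq_factorial_mul_of_isSymmetricPhase hu g f,
        ← integral_const_mul, setIntegral_congr_fun (measurableSet_strictMono M) (had M g f),
        Finset.sum_eq_single_of_mem M (Finset.mem_range.2 (by omega)),
        Finset.sum_eq_single_of_mem (adWord M) (Finset.mem_univ _)]
      · intro w _ hw
        obtain ⟨i, hi⟩ : ∃ i, w.1 i ≠ Ladder.ad :=
          not_forall.1 fun h => hw (Subtype.ext (funext h))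
        simp [wordIntegrand_eq_zero B Q T w hi]
      · intro n _ hn
        refine Finset.sum_eq_zero fun w _ => ?_
        obtain ⟨i, hi⟩ : ∃ i, w.1 i ≠ Ladder.ad :=
          not_forall.1 fun h => hn (w.card_eq_of_forall_eq_ad h).1
        simp [wordIntegrand_eq_zero B Q T w hi]
    · rw [inner_inSector_of_ne hMN, eq_comm]
      refine Finset.sum_eq_zero fun n _ => Finset.sum_eq_zero fun w _ => ?_
      obtain ⟨i, hi⟩ : ∃ i, w.1 i ≠ Ladder.ad := not_forall.1 fun h =>
        hMN ((w.card_eq_of_forall_eq_ad h).1.symm.trans (w.card_eq_of_forall_eq_ad h).2)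
      simp [wordIntegrand_eq_zero B Q T w hi]

end

end ContinuousMPO

theorem mainTheorem6 (a b : EReal) (hab : a < b) (D : ℕ) (k : Fin D)
    (q : Fin D → ℝ → ℝ)
    (hq : ∀ j, MeasureTheory.IntegrableOn (q j) (ContinuousMPO.interval a b))
    (T : ℝ → Matrix (Fin D) (Fin D) ℂ)
    (hT_meas : ∀ i j, AEMeasurable (fun x => T x i j)
      (MeasureTheory.volume.restrict (ContinuousMPO.interval a b)))
    (hT : ∀ x ∈ ContinuousMPO.interval a b, T x ∈ ContinuousMPO.phasePermutations D)
    (Q : ℝ → Matrix (Fin D) (Fin D) ℂ)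
    (hQ : ∀ x, Q x = Complex.I • Matrix.diagonal fun j => (q j x : ℂ))
    (B : Matrix (Fin D) (Fin D) ℂ)
    (hB : B = ContinuousMPO.propagator Q b a * ContinuousMPO.ketPlus k) :
    ∃ U : ContinuousMPO.FockSpace a b →L[ℂ] ContinuousMPO.FockSpace a b,
      ContinuousMPO.IsPhaseCMPU B Q T U ∧
      ∀ U' : ContinuousMPO.FockSpace a b →L[ℂ] ContinuousMPO.FockSpace a b,
        ContinuousMPO.IsCMPO B Q (fun _ => 0) (fun _ => 0) T U' → U' = U := by
  obtain rfl : Q = fun x => Matrix.diagonal fun j => Complex.I * (q j x : ℂ) := by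
    funext x
    rw [hQ, ← Matrix.diagonal_smul]
    rfl
  subst hB
  set Q : ℝ → Matrix (Fin D) (Fin D) ℂ := fun x => Matrix.diagonal fun j => Complex.I * (q j x : ℂ)
  set B := ContinuousMPO.propagator Q b a * ContinuousMPO.ketPlus k
  have hp : ∀ j, MeasureTheory.IntegrableOn (fun x => Complex.I * (q j x : ℂ))
      (ContinuousMPO.interval a b) := fun j =>
    (MeasureTheory.Integrable.ofReal (hq j)).const_mul Complex.I
  have hn : ∀ (N : ℕ) (x : Fin N → ℝ), (∀ i, x i ∈ ContinuousMPO.interval a b) →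
      ‖ContinuousMPO.coefficient a b B Q N x fun i => T (x i)‖ = 1 := fun N x hx =>
    ContinuousMPO.norm_coefficient hab.le hq k N hx fun i =>
      ContinuousMPO.isPhaseMonomial_of_mem_phasePermutations (hT _ (hx i))
  have hu := ContinuousMPO.isSymmetricPhase_comp_sort
    (φ := fun N x => ContinuousMPO.coefficient a b B Q N x fun i => T (x i))
    (fun N => ContinuousMPO.aemeasurable_coefficient hab.le hp B N hT_meas) hn
  have hU := ContinuousMPO.isCMPO_fockPhase B Q T hu
  have hphase : ∀ (N : ℕ) (x : Fin N → ℝ), (∀ i, x i ∈ ContinuousMPO.interval a b) →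
      ContinuousMPO.coefficient a b B Q N x (fun i => T (x i)) = Complex.exp (Complex.I *
        ((ContinuousMPO.coefficient a b B Q N x fun i => T (x i)).arg : ℂ)) := fun N x hx => by
    have h := Complex.norm_mul_exp_arg_mul_I
      (ContinuousMPO.coefficient a b B Q N x fun i => T (x i))
    rw [hn N x hx, Complex.ofReal_one, one_mul, mul_comm] at h
    exact h.symm
  refine ⟨ContinuousMPO.fockPhase _ hu, ⟨hU, ContinuousMPO.fockPhase_mem_unitary hu,
    -- The witness `θ` is the argument of the coefficient, which has modulus one on the interval by
    -- `hn`.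
    fun N x => (ContinuousMPO.coefficient a b B Q N x fun i => T (x i)).arg, hphase,
    fun Ψ j => ?_⟩, fun U' hU' => ?_⟩
  · filter_upwards [ContinuousMPO.coeFn_phaseMul (hu.1 j)
      (Ψ j : MeasureTheory.Lp ℂ 2 (ContinuousMPO.configMeasure a b j)),
      ContinuousMPO.ae_mem_interval a b j] with x hx hxI
    rw [← hphase j (x ∘ Tuple.sort x) fun i => hxI _]
    exact hx
  · exact ContinuousMPO.eq_of_inner_inSector fun M N g f =>
      ((hU' M N g f).2).trans ((hU M N g f).2).symm
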